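/- For a nonempty topological space $X$ let $a$, $b$, $i$, $f$ be the operators on subsets of $X$ that send a set to its complement, closure, interior and boundary respectively, let $\mathrm{id}$ be the identity operator and let $0$ be the operator with constant value $\varnothing$; products denote composition, the rightmost factor being applied first. Let $$\mathsf{KF}^0=\{\mathrm{id},\,b,\,i,\,bi,\,ib,\,bib,\,ibi,\,0,\,f,\,if,\,fif,\,bif,\,ff,\,fb,\,fi,\,fbi,\,fib\},\qquad \mathsf{KF}=\mathsf{KF}^0\cup\{ao : o\in\mathsf{KF}^0\},$$ where the $34$ elements of $\mathsf{KF}$ are regarded as formal symbols that denote operators in every topological space. For a subset $A$ of a nonempty topological space, the ordering of $\mathsf{KF}$ satisfied by $A$ is the relation $$P_A=\{(o_1,o_2)\in\mathsf{KF}\times\mathsf{KF} : o_1A\subseteq o_2A\}$$ (a partial order once operators $o_1,o_2$ with $o_1A=o_2A$ are identified). A relation on $\mathsf{KF}$ is called a local ordering of $\mathsf{KF}$ if it equals $P_A$ for some subset $A$ of some nonempty topological space. Theorem. $\mathsf{KF}$ has exactly $496$ local orderings. -/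

import Mathlib

universe u

namespace GaidaEremenko

/-- Names of the seventeen even Gaida-Eremenko operators: the seven even Kuratowski operators,
followed by the zero operator and the nine nonzero even operators that involve the boundary.
A name lists the factors of the product, the rightmost factor being applied first:
`b` is closure, `i` is interior, `f` is boundary. -/
inductive EvenOp : Type
  | id | b | i | bi | ib | bib | ibi
  | zero | f | i_f | f_i_f | b_i_f | f_f | f_b | f_i | f_b_i | f_i_b

/-- The set operator denoted by an even name in a given topological space. -/
def EvenOp.apply {X : Type*} [TopologicalSpace X] : EvenOp → Set X → Set X
  | .id, A => A
  | .b, A => closure A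
  | .i, A => interior A
  | .bi, A => closure (interior A)
  | .ib, A => interior (closure A)
  | .bib, A => closure (interior (closure A))
  | .ibi, A => interior (closure (interior A))
  | .zero, _ => ∅
  | .f, A => frontier A
  | .i_f, A => interior (frontier A)
  | .f_i_f, A => frontier (interior (frontier A))
  | .b_i_f, A => closure (interior (frontier A))
  | .f_f, A => frontier (frontier A)
  | .f_b, A => frontier (closure A)
  | .f_i, A => frontier (interior A)
  | .f_b_i, A => frontier (closure (interior A))
  | .f_i_b, A => frontier (interior (closure A))

/-- Names of the thirty-four Gaida-Eremenko operators: the even operators `o` and their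
left complements `a o`, where `a` is the complement operator. -/
inductive KF : Type
  | even (o : EvenOp)
  | odd (o : EvenOp)

/-- The set operator denoted by a name in a given topological space. -/
def KF.apply {X : Type*} [TopologicalSpace X] : KF → Set X → Set X
  | .even o, A => o.apply A
  | .odd o, A => (o.apply A)ᶜ

/-- The subset `A` satisfies the ordering `P` of the Gaida-Eremenko operators: `P` holds for
exactly those pairs `(o₁, o₂)` for which `o₁ A ⊆ o₂ A`. -/
def Satisfies {X : Type*} [TopologicalSpace X] (A : Set X) (P : KF → KF → Prop) : Prop :=
  ∀ o₁ o₂ : KF, P o₁ o₂ ↔ o₁.apply A ⊆ o₂.apply A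

/-- A local ordering is an ordering of the Gaida-Eremenko operators that is satisfied by some
subset of some nonempty topological space. It is a reflexive and transitive relation on names,
hence a partial order on the operators once those with equal value at the subset in question
are identified. -/
def IsLocalOrdering (P : KF → KF → Prop) : Prop :=
  ∃ (X : Type u) (_ : TopologicalSpace X) (_ : Nonempty X) (A : Set X), Satisfies A P

end GaidaEremenko

/-! The operators see a point only through its membership in `A`, `b`, `i`, `bi`, `ib`, `ibi` and
`bif`, and the relations between these sets leave sixteen possible types of point
(`exists_hasType`). Hence the ordering depends only on which types `A` realizes.

Some types force others in every neighbourhood. This makes the types a finite space in which the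
realized types always form an open set (`isOpen_realizedTypes`). Conversely that space carries a set
for which each point `t` has type `t` (`EvenOp.apply_support`), and restricting to a nonempty open
subspace realizes exactly its types. So local orderings are the orderings given by nonempty open
sets of types (`isLocalOrdering_iff`).

An inclusion fails exactly when some type in its separator is realized, so an ordering records which
separators are met. Open sets with the same ordering have a largest member, the saturated one; these
representatives are enumerated and counted by evaluation. -/

namespace GaidaEremenko

/-! ### Bit masks -/

/-- Inclusion of bit masks. -/
def Within (m n : ℕ) : Prop := m &&& n = m

instance (m n : ℕ) : Decidable (Within m n) := inferInstanceAs (Decidable (m &&& n = m))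

theorem within_iff {m n : ℕ} : Within m n ↔ ∀ i, m.testBit i = true → n.testBit i = true := by
  unfold Within
  constructor
  · intro h i hi
    rw [← h, Nat.testBit_and, Bool.and_eq_true] at hi
    exact hi.2
  · intro h
    apply Nat.eq_of_testBit_eq
    intro i
    rw [Nat.testBit_and]
    have := h i
    cases hm : m.testBit i <;> simp_all

theorem land_eq_zero_iff {m n : ℕ} :
    m &&& n = 0 ↔ ∀ i, m.testBit i = true → n.testBit i = false := by
  constructor
  · intro h i hi
    have := congrArg (fun k => k.testBit i) h
    simpa [hi] using this
  · intro h
    apply Nat.eq_of_testBit_eq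
    intro i
    have := h i
    cases hm : m.testBit i <;> simp_all

theorem testBit_lt_sixteen {n i : ℕ} (hn : n < 2 ^ 16) (hi : n.testBit i = true) : i < 16 := by
  by_contra hge
  rw [Nat.testBit_lt_two_pow
    (hn.trans_le (Nat.pow_le_pow_right (by decide) (not_lt.1 hge)))] at hi
  exact Bool.false_ne_true hi

theorem lt_lor_of_not_within {m n : ℕ} (h : ¬ Within m n) : n < n ||| m := by
  refine lt_of_le_of_ne Nat.left_le_or fun e => h ?_
  rw [within_iff]
  intro i hi
  rw [e, Nat.testBit_or, hi, Bool.or_true]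

/-! ### Point types -/

/-- The sixteen ways in which a point can lie with respect to a subset `A`. The points of type
`0` form the interior of `A` and those of type `1` the exterior; the types `2, 3` make up
`ib \ bi`, the types `4, 5` make up `ibi \ i`, the types `6, 7` make up `(ib ∩ bi) \ ibi`, the
types `8, …, 11` make up `bi \ ib`, and the types `12, …, 15` make up `b \ (ib ∪ bi)`. Of these,
the types `10, 11, 14, 15` (as well as `2, 3, 6, 7`) lie in `b (i (f A))`. Each type occurs once
for the points of `A` and once for the points outside `A`. -/
def PointType : Type := Fin 16

instance : Fintype PointType := inferInstanceAs (Fintype (Fin 16))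

instance : DecidableEq PointType := inferInstanceAs (DecidableEq (Fin 16))

/-- The position of a point type in a bit mask. -/
def PointType.idx (t : PointType) : ℕ := Fin.val t

theorem PointType.idx_lt (t : PointType) : t.idx < 16 := Fin.isLt t

/-- The point type with a given position. -/
def PointType.ofNat (n : ℕ) (h : n < 16) : PointType := (⟨n, h⟩ : Fin 16)

/-- The mask of those point types that occur in every neighbourhood of a point of the type with
the given position. -/
def nbhdMask (n : ℕ) : ℕ :=
  [1, 2, 12, 12, 17, 49, 77, 141, 259, 515, 1039, 2063, 4098, 12290, 16398, 32782].getD n 0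

/-- The mask of the point types that make up the value of an even operator. -/
def EvenOp.mask : EvenOp → ℕ
  | .id => 39593
  | .b => 65533
  | .i => 1
  | .bi => 4081
  | .ib => 253
  | .bib => 53245
  | .ibi => 49
  | .zero => 0
  | .f => 65532
  | .i_f => 12
  | .f_i_f => 52416
  | .b_i_f => 52428
  | .f_f => 65520
  | .f_b => 65280
  | .f_i => 4080
  | .f_b_i => 4032
  | .f_i_b => 52992

/-- Points of type `t` belong to the value of the even operator `o`. -/
def PointType.Has (t : PointType) (o : EvenOp) : Prop := o.mask.testBit t.idx = true

instance (t : PointType) (o : EvenOp) : Decidable (t.Has o) :=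
  inferInstanceAs (Decidable (_ = true))

/-- The point type `u` occurs in every neighbourhood of a point of type `t`. -/
def PointType.Near (t u : PointType) : Prop := (nbhdMask t.idx).testBit u.idx = true

instance (t u : PointType) : Decidable (t.Near u) := inferInstanceAs (Decidable (_ = true))

/-! ### The finite space of point types -/

theorem PointType.near_refl : ∀ t : PointType, t.Near t := by decide +kernel

theorem PointType.near_trans : ∀ t u v : PointType, t.Near u → u.Near v → t.Near v := by
  decide +kernel

/-- The topology on point types in which the types near `t` form the least neighbourhood of `t`. -/
instance : TopologicalSpace PointType where
  IsOpen s := ∀ t ∈ s, ∀ u, t.Near u → u ∈ s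
  isOpen_univ := fun _ _ _ _ => trivial
  isOpen_inter := fun _ _ hs ht x hx u hu => ⟨hs x hx.1 u hu, ht x hx.2 u hu⟩
  isOpen_sUnion := fun _ h x ⟨s, hs, hx⟩ u hu => ⟨s, hs, h s hs x hx u hu⟩

theorem PointType.isOpen_iff {s : Set PointType} :
    IsOpen s ↔ ∀ t ∈ s, ∀ u, t.Near u → u ∈ s := Iff.rfl

theorem PointType.mem_interior {s : Set PointType} {t : PointType} :
    t ∈ interior s ↔ ∀ u, t.Near u → u ∈ s := by
  constructor
  · intro h u hu
    exact interior_subset (PointType.isOpen_iff.1 isOpen_interior t h u hu)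
  · intro h
    have ho : IsOpen {u | t.Near u} :=
      PointType.isOpen_iff.2 fun v hv w hw => PointType.near_trans t v w hv hw
    exact interior_maximal (fun u hu => h u hu) ho (PointType.near_refl t)

theorem PointType.mem_closure {s : Set PointType} {t : PointType} :
    t ∈ closure s ↔ ∃ u, t.Near u ∧ u ∈ s := by
  rw [closure_eq_compl_interior_compl, Set.mem_compl_iff, PointType.mem_interior]
  simp

/-- The set of point types with a given mask. -/
def support (m : ℕ) : Set PointType := {t | m.testBit t.idx = true}

theorem mem_support {m : ℕ} {t : PointType} : t ∈ support m ↔ m.testBit t.idx = true := Iff.rfl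

theorem interior_support {m n : ℕ}
    (h : ∀ t : PointType, n.testBit t.idx = true ↔
      ∀ u : PointType, t.Near u → m.testBit u.idx = true) :
    interior (support m) = support n := by
  ext t
  rw [PointType.mem_interior, mem_support, h]
  rfl

theorem closure_support {m n : ℕ}
    (h : ∀ t : PointType, n.testBit t.idx = true ↔
      ∃ u : PointType, t.Near u ∧ m.testBit u.idx = true) :
    closure (support m) = support n := by
  ext t
  rw [PointType.mem_closure, mem_support, h]
  rfl

theorem support_diff {m n k : ℕ}
    (h : ∀ t : PointType, k.testBit t.idx = true ↔
      m.testBit t.idx = true ∧ ¬ n.testBit t.idx = true) :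
    support m \ support n = support k := by
  ext t
  rw [Set.mem_sdiff, mem_support, mem_support, mem_support, h]

/-- The universal example: in the space of types, the types of the points of `A` form a set for
which each point has itself as its type. -/
theorem EvenOp.apply_support (o : EvenOp) :
    o.apply (support EvenOp.id.mask) = support o.mask := by
  have hb : closure (support EvenOp.id.mask) = support EvenOp.b.mask :=
    closure_support (by decide +kernel)
  have hi : interior (support EvenOp.id.mask) = support EvenOp.i.mask :=
    interior_support (by decide +kernel)
  have hbi : closure (support EvenOp.i.mask) = support EvenOp.bi.mask :=
    closure_support (by decide +kernel)
  have hib : interior (support EvenOp.b.mask) = support EvenOp.ib.mask :=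
    interior_support (by decide +kernel)
  have hbib : closure (support EvenOp.ib.mask) = support EvenOp.bib.mask :=
    closure_support (by decide +kernel)
  have hibi : interior (support EvenOp.bi.mask) = support EvenOp.ibi.mask :=
    interior_support (by decide +kernel)
  have hf : support EvenOp.b.mask \ support EvenOp.i.mask = support EvenOp.f.mask :=
    support_diff (by decide +kernel)
  have hif : interior (support EvenOp.f.mask) = support EvenOp.i_f.mask :=
    interior_support (by decide +kernel)
  have hbif : closure (support EvenOp.i_f.mask) = support EvenOp.b_i_f.mask :=
    closure_support (by decide +kernel)
  have hbf : closure (support EvenOp.f.mask) = support EvenOp.f.mask :=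
    closure_support (by decide +kernel)
  have hbb : closure (support EvenOp.b.mask) = support EvenOp.b.mask :=
    closure_support (by decide +kernel)
  have hbbi : closure (support EvenOp.bi.mask) = support EvenOp.bi.mask :=
    closure_support (by decide +kernel)
  have hii : interior (support EvenOp.i.mask) = support EvenOp.i.mask :=
    interior_support (by decide +kernel)
  have hiib : interior (support EvenOp.ib.mask) = support EvenOp.ib.mask :=
    interior_support (by decide +kernel)
  have hiif : interior (support EvenOp.i_f.mask) = support EvenOp.i_f.mask :=
    interior_support (by decide +kernel)
  cases o
  case id => rfl
  case zero =>
    ext t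
    simp [EvenOp.apply, EvenOp.mask, mem_support]
  all_goals
    simp only [EvenOp.apply, frontier, hb, hi, hii, hiib, hiif, hbi, hib, hbib, hibi, hf, hif,
      hbif, hbf, hbb, hbbi]
  all_goals
    exact support_diff (by decide +kernel)

/-- Preimage under a continuous open map commutes with closure, interior and frontier. Applied to
the inclusion of an open subspace, this shows that restriction preserves types. -/
theorem EvenOp.apply_preimage {X Y : Type*} [TopologicalSpace X] [TopologicalSpace Y]
    {g : X → Y} (hc : Continuous g) (ho : IsOpenMap g) (o : EvenOp) (A : Set Y) :
    o.apply (g ⁻¹' A) = g ⁻¹' o.apply A := by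
  cases o <;>
    simp [EvenOp.apply, ← ho.preimage_closure_eq_closure_preimage hc,
      ← ho.preimage_interior_eq_interior_preimage hc,
      ← ho.preimage_frontier_eq_frontier_preimage hc]

/-! ### The point types realized by a subset -/

section

variable {X : Type*} [TopologicalSpace X] {A : Set X}

/-- The point `x` has type `t` with respect to `A`. -/
def HasType (A : Set X) (x : X) (t : PointType) : Prop := ∀ o : EvenOp, x ∈ o.apply A ↔ t.Has o

theorem interior_frontier_eq (A : Set X) :
    interior (frontier A) = interior (closure A) \ closure (interior A) := by
  rw [frontier_eq_closure_inter_closure, interior_inter, Set.sdiff_eq,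
    ← interior_compl, ← closure_compl]

/-- A point of `ib` outside `bi` lies in `if`. Thus `bib` is determined by `bi` and `bif` and adds
no further invariant. -/
theorem closure_interior_closure_eq (A : Set X) :
    closure (interior (closure A)) =
      closure (interior A) ∪ closure (interior (frontier A)) := by
  apply subset_antisymm
  · rw [← closure_union]
    apply closure_minimal _ isClosed_closure
    intro x hx
    by_cases h : x ∈ closure (interior A)
    · exact closure_mono Set.subset_union_left h
    · exact subset_closure (Or.inr (by rw [interior_frontier_eq]; exact ⟨hx, h⟩))
  · exact Set.union_subset (closure_mono (interior_mono subset_closure))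
      (closure_mono (interior_mono frontier_subset_closure))

theorem disjoint_closure_interior_frontier (A : Set X) :
    Disjoint (interior (closure (interior A))) (closure (interior (frontier A))) := by
  apply Disjoint.closure_right _ isOpen_interior
  rw [interior_frontier_eq]
  exact Set.disjoint_left.2 fun x hx hx' => hx'.2 (interior_subset hx)

/-- If a neighbourhood of `x` missed `if`, its intersection with `ib` would be an open set inside
`bi`, putting `x` in `ibi`. -/
theorem mem_closure_interior_frontier {x : X} (hb : x ∈ interior (closure A))
    (hi : x ∉ interior (closure (interior A))) : x ∈ closure (interior (frontier A)) := by
  rw [mem_closure_iff]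
  intro o ho hx
  by_contra h
  apply hi
  refine interior_maximal (fun y hy => ?_) (ho.inter isOpen_interior) ⟨hx, hb⟩
  by_contra hy'
  exact h ⟨y, hy.1, by rw [interior_frontier_eq]; exact ⟨hy.2, hy'⟩⟩

set_option synthInstance.maxSize 1000 in
theorem exists_hasType (A : Set X) (x : X) : ∃ t, HasType A x t := by
  have key : ∀ d b i bi ib ibi bf : Bool, (i → d) → (d → b) → (i → ibi) → (ibi → bi) →
      (ibi → ib) → (ib → b) → (bi → b) → (bf → b) → (ibi → ¬ bf) → (ib → ¬ ibi → bf) →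
      ∃ t : PointType, (d ↔ t.Has .id) ∧ (b ↔ t.Has .b) ∧ (i ↔ t.Has .i) ∧ (bi ↔ t.Has .bi) ∧
        (ib ↔ t.Has .ib) ∧ (ibi ↔ t.Has .ibi) ∧ (bf ↔ t.Has .b_i_f) := by
    decide +kernel
  classical
  have h1 : x ∈ interior A → x ∈ A := fun h => interior_subset h
  have h2 : x ∈ A → x ∈ closure A := fun h => subset_closure h
  have h3 : x ∈ interior A → x ∈ interior (closure (interior A)) :=
    fun h => interior_maximal subset_closure isOpen_interior h
  have h4 : x ∈ interior (closure (interior A)) → x ∈ closure (interior A) :=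
    fun h => interior_subset h
  have h5 : x ∈ interior (closure (interior A)) → x ∈ interior (closure A) :=
    fun h => interior_mono (closure_mono interior_subset) h
  have h6 : x ∈ interior (closure A) → x ∈ closure A := fun h => interior_subset h
  have h7 : x ∈ closure (interior A) → x ∈ closure A := fun h => closure_mono interior_subset h
  have h8 : x ∈ closure (interior (frontier A)) → x ∈ closure A := fun h =>
    closure_minimal (interior_subset.trans frontier_subset_closure) isClosed_closure h
  have h9 : x ∈ interior (closure (interior A)) → x ∉ closure (interior (frontier A)) :=
    fun h h' => Set.disjoint_left.1 (disjoint_closure_interior_frontier A) h h'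
  have h10 : x ∈ interior (closure A) → x ∉ interior (closure (interior A)) →
      x ∈ closure (interior (frontier A)) := mem_closure_interior_frontier
  obtain ⟨t, k1, k2, k3, k4, k5, k6, k7⟩ := key (decide (x ∈ A)) (decide (x ∈ closure A))
    (decide (x ∈ interior A)) (decide (x ∈ closure (interior A)))
    (decide (x ∈ interior (closure A))) (decide (x ∈ interior (closure (interior A))))
    (decide (x ∈ closure (interior (frontier A))))
    (by simpa using h1) (by simpa using h2) (by simpa using h3) (by simpa using h4)
    (by simpa using h5) (by simpa using h6) (by simpa using h7) (by simpa using h8)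
    (by simpa using h9) (by simpa using h10)
  simp only [decide_eq_true_eq] at k1 k2 k3 k4 k5 k6 k7
  have t1 : ∀ t : PointType, (t.Has .bib ↔ t.Has .bi ∨ t.Has .b_i_f) ∧ ¬ t.Has .zero ∧
      (t.Has .f ↔ t.Has .b ∧ ¬ t.Has .i) ∧ (t.Has .i_f ↔ t.Has .ib ∧ ¬ t.Has .bi) := by
    decide +kernel
  have t2 : ∀ t : PointType, (t.Has .f_i_f ↔ t.Has .b_i_f ∧ ¬ t.Has .i_f) ∧
      (t.Has .f_f ↔ t.Has .f ∧ ¬ t.Has .i_f) ∧ (t.Has .f_b ↔ t.Has .b ∧ ¬ t.Has .ib) ∧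
      (t.Has .f_i ↔ t.Has .bi ∧ ¬ t.Has .i) ∧ (t.Has .f_b_i ↔ t.Has .bi ∧ ¬ t.Has .ibi) ∧
      (t.Has .f_i_b ↔ t.Has .bib ∧ ¬ t.Has .ib) := by
    decide +kernel
  obtain ⟨tbib, tz, tf, tif⟩ := t1 t
  obtain ⟨tfif, tff, tfb, tfi, tfbi, tfib⟩ := t2 t
  have kf : x ∈ frontier A ↔ t.Has .f := by
    rw [tf, frontier, Set.mem_sdiff, k2, k3]
  have kif : x ∈ interior (frontier A) ↔ t.Has .i_f := by
    rw [tif, interior_frontier_eq, Set.mem_sdiff, k4, k5]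
  have kbib : x ∈ closure (interior (closure A)) ↔ t.Has .bib := by
    rw [tbib, closure_interior_closure_eq, Set.mem_union, k4, k7]
  refine ⟨t, fun o => ?_⟩
  cases o
  case id => exact k1
  case b => exact k2
  case i => exact k3
  case bi => exact k4
  case ib => exact k5
  case bib => exact kbib
  case ibi => exact k6
  case zero => exact ⟨fun h => h.elim, fun h => (tz h).elim⟩
  case f => exact kf
  case i_f => exact kif
  case b_i_f => exact k7
  case f_i_f =>
    rw [tfif, ← k7, ← kif, EvenOp.apply, frontier, interior_interior, Set.mem_sdiff]
  case f_f =>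
    rw [tff, ← kf, ← kif, EvenOp.apply, isClosed_frontier.frontier_eq, Set.mem_sdiff]
  case f_b =>
    rw [tfb, ← k2, ← k5, EvenOp.apply, isClosed_closure.frontier_eq, Set.mem_sdiff]
  case f_i =>
    rw [tfi, ← k4, ← k3, EvenOp.apply, frontier, interior_interior, Set.mem_sdiff]
  case f_b_i =>
    rw [tfbi, ← k4, ← k6, EvenOp.apply, isClosed_closure.frontier_eq, Set.mem_sdiff]
  case f_i_b =>
    rw [tfib, ← kbib, ← k5, EvenOp.apply, frontier, interior_interior, Set.mem_sdiff]

/-- The point types realized by `A`. -/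
def realizedTypes (A : Set X) : Set PointType := {t | ∃ x, HasType A x t}

-- A type near `t` other than `t` itself is one of 0, 1, 2, 3, 4, 12. Each of these is the only type
-- in some region that a point of type `t` forces to be nonempty, and any point of that region
-- realizes it.
set_option synthInstance.maxSize 1000 in
theorem isOpen_realizedTypes (A : Set X) : IsOpen (realizedTypes A) := by
  rw [PointType.isOpen_iff]
  rintro t ⟨x, hx⟩ u htu
  have key : ∀ t u : PointType, t.Near u → u = t ∨
      (t.Has .bi ∧ ∀ v : PointType, v.Has .i → v = u) ∨
      (¬ t.Has .ib ∧ ∀ v : PointType, ¬ v.Has .b → v = u) ∨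
      (t.Has .b_i_f ∧ ((∀ v : PointType, v.Has .i_f → v.Has .id → v = u) ∨
        ∀ v : PointType, v.Has .i_f → ¬ v.Has .id → v = u)) ∨
      ((t.Has .ibi ∧ ¬ t.Has .i) ∧
        ∀ v : PointType, v.Has .ibi → ¬ v.Has .id → v = u) ∨
      ((t.Has .b ∧ ¬ t.Has .bib) ∧
        ∀ v : PointType, v.Has .id → ¬ v.Has .bib → v = u) := by
    decide +kernel
  rcases key t u htu with rfl | ⟨h, hu⟩ | ⟨h, hu⟩ | ⟨h, hu⟩ | ⟨⟨h, h'⟩, hu⟩ | ⟨⟨h, h'⟩, hu⟩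
  · exact ⟨x, hx⟩
  · obtain ⟨y, hy⟩ : (interior A).Nonempty :=
      closure_nonempty_iff.1 ⟨x, (hx .bi).2 h⟩
    obtain ⟨v, hv⟩ := exists_hasType A y
    exact ⟨y, hu v ((hv .i).1 hy) ▸ hv⟩
  · have hx' : x ∉ interior (closure A) := fun k => h ((hx .ib).1 k)
    obtain ⟨y, hy⟩ : ∃ y, y ∉ closure A := by
      by_contra! k
      rw [Set.eq_univ_of_forall k, interior_univ] at hx'
      exact hx' trivial
    obtain ⟨v, hv⟩ := exists_hasType A y
    exact ⟨y, hu v (fun k => hy ((hv .b).2 k)) ▸ hv⟩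
  · obtain ⟨z, hz⟩ : (interior (frontier A)).Nonempty :=
      closure_nonempty_iff.1 ⟨x, (hx .b_i_f).2 h⟩
    rcases hu with hu | hu
    · obtain ⟨y, hy, hyA⟩ := mem_closure_iff.1
        (frontier_subset_closure (interior_subset hz)) _ isOpen_interior hz
      obtain ⟨v, hv⟩ := exists_hasType A y
      exact ⟨y, hu v ((hv .i_f).1 hy) ((hv .id).1 hyA) ▸ hv⟩
    · have hz' : z ∈ closure Aᶜ := by
        have := interior_subset hz
        rw [frontier_eq_closure_inter_closure] at this
        exact this.2
      obtain ⟨y, hy, hyA⟩ := mem_closure_iff.1 hz' _ isOpen_interior hz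
      obtain ⟨v, hv⟩ := exists_hasType A y
      exact ⟨y, hu v ((hv .i_f).1 hy) (fun k => hyA ((hv .id).2 k)) ▸ hv⟩
  · have hx' : x ∉ interior A := fun k => h' ((hx .i).1 k)
    obtain ⟨y, hy, hyA⟩ : ∃ y ∈ interior (closure (interior A)), y ∉ A := by
      by_contra! k
      exact hx' (interior_maximal k isOpen_interior ((hx .ibi).2 h))
    obtain ⟨v, hv⟩ := exists_hasType A y
    exact ⟨y, hu v ((hv .ibi).1 hy) (fun k => hyA ((hv .id).2 k)) ▸ hv⟩
  · have hx' : x ∈ (closure (interior (closure A)))ᶜ := fun k => h' ((hx .bib).1 k)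
    obtain ⟨y, hy, hyA⟩ := mem_closure_iff.1 ((hx .b).2 h) _ isClosed_closure.isOpen_compl hx'
    obtain ⟨v, hv⟩ := exists_hasType A y
    exact ⟨y, hu v ((hv .id).1 hyA) (fun k => hy ((hv .bib).2 k)) ▸ hv⟩

end

/-! ### Orderings from masks -/

/-- The mask of the point types that make up the value of an operator. -/
def KF.mask : KF → ℕ
  | .even o => o.mask
  | .odd o => 65535 ^^^ o.mask

/-- The mask of the point types that lie in the value of `o₁` and not in that of `o₂`. -/
def separator (o₁ o₂ : KF) : ℕ := o₁.mask &&& (65535 ^^^ o₂.mask)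

/-- The ordering of the operators given by the point types in a mask. -/
def ordering (n : ℕ) (o₁ o₂ : KF) : Prop := separator o₁ o₂ &&& n = 0

theorem testBit_full_xor (m : ℕ) (t : PointType) :
    (65535 ^^^ m).testBit t.idx = !m.testBit t.idx := by
  have : ∀ t : PointType, Nat.testBit 65535 t.idx = true := by decide +kernel
  rw [Nat.testBit_xor, this, Bool.true_xor]

theorem KF.mem_apply_iff {X : Type*} [TopologicalSpace X] {A : Set X} {x : X} {t : PointType}
    (h : HasType A x t) (o : KF) : x ∈ o.apply A ↔ o.mask.testBit t.idx = true := by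
  cases o with
  | even o => exact h o
  | odd o =>
    rw [KF.mask, testBit_full_xor, KF.apply, Set.mem_compl_iff, h o, PointType.Has]
    simp

theorem EvenOp.mask_lt (o : EvenOp) : o.mask < 2 ^ 16 := by
  cases o <;> decide

theorem separator_lt (o₁ o₂ : KF) : separator o₁ o₂ < 2 ^ 16 := by
  refine lt_of_le_of_lt Nat.and_le_left ?_
  cases o₁ with
  | even o => exact o.mask_lt
  | odd o => exact Nat.xor_lt_two_pow (by decide) o.mask_lt

theorem ordering_iff {n : ℕ} {o₁ o₂ : KF} :
    ordering n o₁ o₂ ↔ ∀ t ∈ support n, o₁.mask.testBit t.idx = true →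
      o₂.mask.testBit t.idx = true := by
  rw [ordering, land_eq_zero_iff]
  constructor
  · intro h t ht h₁
    have := h t.idx
    rw [separator, Nat.testBit_and, testBit_full_xor, h₁, mem_support.1 ht] at this
    simpa using this
  · intro h i hi
    obtain ⟨t, rfl⟩ : ∃ t : PointType, t.idx = i :=
      ⟨.ofNat i (testBit_lt_sixteen (separator_lt o₁ o₂) hi), rfl⟩
    rw [separator, Nat.testBit_and, testBit_full_xor] at hi
    by_contra hn
    have := h t (by simpa [mem_support] using hn)
    simp_all

/-! ### Open masks and local orderings -/

/-- A mask of point types that is open in the space of point types. -/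
def OpenMask (n : ℕ) : Prop := n < 2 ^ 16 ∧ ∀ t < 16, n.testBit t = true → Within (nbhdMask t) n

instance (n : ℕ) : Decidable (OpenMask n) := inferInstanceAs (Decidable (_ ∧ _))

theorem nbhdMask_lt : ∀ t < 16, nbhdMask t < 2 ^ 16 := by decide

theorem OpenMask.isOpen {n : ℕ} (h : OpenMask n) : IsOpen (support n) := by
  rw [PointType.isOpen_iff]
  intro t ht u hu
  exact within_iff.1 (h.2 t.idx t.idx_lt ht) _ hu

theorem exists_openMask {s : Set PointType} (hs : IsOpen s) : ∃ n, OpenMask n ∧ support n = s := by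
  classical
  let v : BitVec 16 := BitVec.ofFnLE fun i : Fin 16 => decide ((i : PointType) ∈ s)
  have hv : ∀ t : PointType, v.toNat.testBit t.idx = true ↔ t ∈ s := by
    intro t
    have := t.idx_lt
    rw [BitVec.testBit_toNat, BitVec.getLsbD_ofFnLE]
    simp [this]
    rfl
  refine ⟨v.toNat, ⟨v.isLt, fun t ht h => within_iff.2 fun i hi => ?_⟩, ?_⟩
  · have hi' := testBit_lt_sixteen (nbhdMask_lt t ht) hi
    exact (hv (.ofNat i hi')).2 (PointType.isOpen_iff.1 hs _ ((hv (.ofNat t ht)).1 h) _ hi)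
  · ext t
    exact hv t

theorem isLocalOrdering_iff {P : KF → KF → Prop} :
    IsLocalOrdering.{u} P ↔ ∃ n, OpenMask n ∧ n ≠ 0 ∧ ordering n = P := by
  constructor
  · rintro ⟨X, _, ⟨x₀⟩, A, hA⟩
    obtain ⟨n, hn, hs⟩ := exists_openMask (isOpen_realizedTypes A)
    refine ⟨n, hn, ?_, ?_⟩
    · rintro rfl
      obtain ⟨t, ht⟩ := exists_hasType A x₀
      have : t ∈ support 0 := hs ▸ ⟨x₀, ht⟩
      simp [mem_support] at this
    · funext o₁ o₂
      apply propext
      rw [hA, ordering_iff, hs]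
      constructor
      · intro h x hx
        obtain ⟨t, ht⟩ := exists_hasType A x
        exact (KF.mem_apply_iff ht o₂).2 (h t ⟨x, ht⟩ ((KF.mem_apply_iff ht o₁).1 hx))
      · rintro h t ⟨x, ht⟩ h₁
        exact (KF.mem_apply_iff ht o₂).1 (h ((KF.mem_apply_iff ht o₁).2 h₁))
  · rintro ⟨n, hn, hn0, rfl⟩
    -- The open subspace itself, lifted to the required universe; the set pulled back along `g`
    -- gives each point `x` the type `g x`.
    let g : ULift.{u} (support n) → PointType := fun x => x.down.1
    have hc : Continuous g := continuous_subtype_val.comp continuous_uliftDown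
    have ho : IsOpenMap g :=
      hn.isOpen.isOpenMap_subtype_val.comp Homeomorph.ulift.isOpenMap
    have hg : ∀ x, HasType (g ⁻¹' support EvenOp.id.mask) x (g x) := by
      intro x o
      rw [EvenOp.apply_preimage hc ho, EvenOp.apply_support]
      rfl
    refine ⟨ULift.{u} (support n), inferInstance, ?_, g ⁻¹' support EvenOp.id.mask, ?_⟩
    · by_contra he
      apply hn0
      apply Nat.eq_of_testBit_eq
      intro i
      rw [Nat.zero_testBit]
      by_contra hi
      rw [Bool.not_eq_false] at hi
      exact he ⟨⟨⟨.ofNat i (testBit_lt_sixteen hn.1 hi), hi⟩⟩⟩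
    · intro o₁ o₂
      rw [ordering_iff]
      constructor
      · intro h x hx
        exact (KF.mem_apply_iff (hg x) o₂).2
          (h _ x.down.2 ((KF.mem_apply_iff (hg x) o₁).1 hx))
      · intro h t ht h₁
        exact (KF.mem_apply_iff (hg ⟨⟨t, ht⟩⟩) o₂).1
          (h ((KF.mem_apply_iff (hg ⟨⟨t, ht⟩⟩) o₁).2 h₁))

/-! ### The largest mask of an ordering -/

/-- The separators that are not unions of smaller ones. -/
def separators : List ℕ :=
  [1, 2, 4, 8, 16, 33, 48, 84, 169, 192, 768, 1344, 2688, 2720, 3264, 3840, 4096, 4641, 8194,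
    8466, 12288, 17472, 17664, 24582, 25856, 34944, 35328, 36872, 49152, 52224]

/-- A list of all even operators. -/
def evenOps : List EvenOp :=
  [.id, .b, .i, .bi, .ib, .bib, .ibi, .zero, .f, .i_f, .f_i_f, .b_i_f, .f_f, .f_b, .f_i, .f_b_i,
    .f_i_b]

/-- A list of all operators. -/
def operators : List KF := evenOps.map .even ++ evenOps.map .odd

theorem mem_operators (o : KF) : o ∈ operators := by
  rcases o with o | o <;> cases o <;> simp [operators, evenOps]

/-- The union of a list of masks. -/
def union : List ℕ → ℕ := List.foldr (· ||| ·) 0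

theorem testBit_union {l : List ℕ} {i : ℕ} :
    (union l).testBit i = true ↔ ∃ m ∈ l, m.testBit i = true := by
  induction l with
  | nil => simp [union]
  | cons a l ih =>
    rw [union, List.foldr_cons, ← union, Nat.testBit_or, Bool.or_eq_true, ih]
    simp

theorem exists_separator : ∀ w ∈ separators, ∃ o₁ ∈ operators, ∃ o₂ ∈ operators,
    separator o₁ o₂ = w := by
  decide +kernel

/-- Every separator is the union of the irreducible ones inside it, so a mask meets it exactly when
it meets one of those. -/
theorem union_separators : ∀ o₁ ∈ operators, ∀ o₂ ∈ operators,
    union (separators.filter fun w => Within w (separator o₁ o₂)) = separator o₁ o₂ := by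
  decide +kernel

/-- Two masks give the same ordering when they meet the same irreducible separators. -/
theorem ordering_eq_iff {m n : ℕ} :
    ordering m = ordering n ↔ ∀ w ∈ separators, w &&& m = 0 ↔ w &&& n = 0 := by
  constructor
  · intro h w hw
    obtain ⟨o₁, -, o₂, -, rfl⟩ := exists_separator w hw
    exact iff_of_eq (congrFun (congrFun h o₁) o₂)
  · intro h
    funext o₁ o₂
    apply propext
    rw [ordering, ordering, ← union_separators o₁ (mem_operators o₁) o₂ (mem_operators o₂)]
    have key : ∀ (l : List ℕ) (k : ℕ), union l &&& k = 0 ↔ ∀ w ∈ l, w &&& k = 0 := by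
      intro l k
      simp only [land_eq_zero_iff, testBit_union]
      exact ⟨fun h w hw i hi => h i ⟨w, hw, hi⟩, fun h i ⟨w, hw, hi⟩ => h w hw i hi⟩
    rw [key, key]
    exact forall₂_congr fun w hw => h w (List.mem_of_mem_filter hw)

/-- The union of the irreducible separators that do not meet a mask. -/
def avoided (n : ℕ) : ℕ := union (separators.filter fun w => w &&& n = 0)

/-- The mask is the largest among the open masks with the same ordering. -/
def Saturated (n : ℕ) : Prop :=
  ∀ t < 16, Within (nbhdMask t) n ∨ ¬ nbhdMask t &&& avoided n = 0

theorem near_self (t : ℕ) (h : t < 16) : (nbhdMask t).testBit t = true :=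
  PointType.near_refl (.ofNat t h)

/-- If `t` lies in `n`, so does its least neighbourhood, which therefore misses every separator that
`n`, equivalently `m`, misses. Saturation then puts `t` in `m`. -/
theorem within_of_ordering_eq {m n : ℕ} (hm : Saturated m) (hn : OpenMask n)
    (h : ordering m = ordering n) : Within n m := by
  rw [within_iff]
  intro t ht
  have hlt := testBit_lt_sixteen hn.1 ht
  rcases hm t hlt with hw | hw
  · exact within_iff.1 hw t (near_self t hlt)
  · refine absurd (land_eq_zero_iff.2 fun i hi => ?_) hw
    by_contra hne
    rw [Bool.not_eq_false, avoided, testBit_union] at hne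
    obtain ⟨w, hws, hwi⟩ := hne
    rw [List.mem_filter, decide_eq_true_eq] at hws
    have h0 := land_eq_zero_iff.1 ((ordering_eq_iff.1 h w hws.1).1 hws.2) i hwi
    rw [within_iff.1 (hn.2 t hlt ht) i hi] at h0
    exact Bool.false_ne_true h0.symm

theorem eq_of_ordering_eq {m n : ℕ} (hm : OpenMask m ∧ Saturated m) (hn : OpenMask n ∧ Saturated n)
    (h : ordering m = ordering n) : m = n := by
  have h₁ : n &&& m = n := within_of_ordering_eq hm.2 hn.1 h
  have h₂ : m &&& n = m := within_of_ordering_eq hn.2 hm.1 h.symm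
  rw [← h₂, Nat.and_comm, h₁]

theorem OpenMask.lor_nbhdMask {n t : ℕ} (hn : OpenMask n) (ht : t < 16) :
    OpenMask (n ||| nbhdMask t) := by
  refine ⟨Nat.or_lt_two_pow hn.1 (nbhdMask_lt t ht), fun s hs h => within_iff.2 fun i hi => ?_⟩
  rw [Nat.testBit_or, Bool.or_eq_true] at h ⊢
  rcases h with h | h
  · exact Or.inl (within_iff.1 (hn.2 s hs h) i hi)
  · exact Or.inr (PointType.near_trans (.ofNat t ht) (.ofNat s hs)
      (.ofNat i (testBit_lt_sixteen (nbhdMask_lt s hs) hi)) h hi)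

/-- The added types lie in no separator missed by `n`, so these stay missed, and those already met
stay met. -/
theorem ordering_lor_nbhdMask {n t : ℕ} (h : nbhdMask t &&& avoided n = 0) :
    ordering (n ||| nbhdMask t) = ordering n := by
  rw [ordering_eq_iff]
  intro w hw
  rw [Nat.and_or_distrib_left, Nat.or_eq_zero_iff]
  refine ⟨fun k => k.1, fun k => ⟨k, land_eq_zero_iff.2 fun i hi => ?_⟩⟩
  by_contra hne
  rw [Bool.not_eq_false] at hne
  have hav : (avoided n).testBit i = true :=
    testBit_union.2 ⟨w, List.mem_filter.2 ⟨hw, decide_eq_true k⟩, hi⟩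
  rw [land_eq_zero_iff.1 h i hne] at hav
  exact Bool.false_ne_true hav

theorem exists_saturated {n : ℕ} (hn : OpenMask n) :
    ∃ m, (OpenMask m ∧ Saturated m) ∧ n ≤ m ∧ ordering m = ordering n := by
  classical
  -- The numerically greatest mask suffices: adjoining a neighbourhood not already contained would
  -- increase the number.
  let s := (Finset.range (2 ^ 16)).filter fun m => OpenMask m ∧ n ≤ m ∧ ordering m = ordering n
  have hne : s.Nonempty := ⟨n, by simpa [s] using ⟨hn.1, hn⟩⟩
  have hmax := s.max'_mem hne
  set m := s.max' hne with hm
  obtain ⟨-, ho, hle, hord⟩ := Finset.mem_filter.1 hmax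
  refine ⟨m, ⟨ho, fun t ht => ?_⟩, hle, hord⟩
  by_contra! hcon
  have hlt := lt_lor_of_not_within hcon.1
  have hos := ho.lor_nbhdMask ht
  have hmem : m ||| nbhdMask t ∈ s := Finset.mem_filter.2
    ⟨Finset.mem_range.2 hos.1, hos, hle.trans hlt.le, (ordering_lor_nbhdMask hcon.2).trans hord⟩
  exact absurd (s.le_max' _ hmem) (not_le.2 hlt)

/-! ### Counting -/

/-- The masks on the first `k` point types that contain, with each type, the preceding types
near it. -/
def candidates : ℕ → List ℕ
  | 0 => [0]
  | k + 1 => candidates k ++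
      ((candidates k).filter fun n => Within (nbhdMask k % 2 ^ k) n).map (2 ^ k + ·)

theorem lt_of_mem_candidates {k n : ℕ} (h : n ∈ candidates k) : n < 2 ^ k := by
  induction k generalizing n with
  | zero => simpa [candidates] using h
  | succ k ih =>
    rw [candidates, List.mem_append, List.mem_map] at h
    rw [pow_succ]
    rcases h with h | ⟨m, hm, rfl⟩
    · have := ih h
      omega
    · have := ih (List.mem_of_mem_filter hm)
      omega

theorem nodup_candidates (k : ℕ) : (candidates k).Nodup := by
  induction k with
  | zero => simp [candidates]
  | succ k ih =>
    rw [candidates, List.nodup_append']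
    refine ⟨ih, (ih.filter _).map (add_right_injective _), fun n hn hn' => ?_⟩
    obtain ⟨m, -, rfl⟩ := List.mem_map.1 hn'
    have := lt_of_mem_candidates hn
    omega

theorem OpenMask.mod_mem_candidates {n : ℕ} (h : OpenMask n) {k : ℕ} (hk : k ≤ 16) :
    n % 2 ^ k ∈ candidates k := by
  induction k with
  | zero => simp [candidates, Nat.mod_one]
  | succ k ih =>
    have ih := ih (by omega)
    rw [candidates, List.mem_append, List.mem_map, Nat.mod_pow_succ]
    have hbit := Nat.testBit_eq_decide_div_mod_eq (x := n) (i := k)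
    cases hb : n.testBit k with
    | false =>
      rw [hb, eq_comm, decide_eq_false_iff_not] at hbit
      rw [show n / 2 ^ k % 2 = 0 by omega]
      exact Or.inl ih
    | true =>
      rw [hb, eq_comm, decide_eq_true_eq] at hbit
      refine Or.inr ⟨n % 2 ^ k, List.mem_filter.2 ⟨ih, decide_eq_true (within_iff.2 ?_)⟩, ?_⟩
      · intro i hi
        rw [Nat.testBit_mod_two_pow, Bool.and_eq_true] at hi ⊢
        exact ⟨hi.1, within_iff.1 (h.2 k (by omega) hb) i hi.2⟩
      · rw [hbit, mul_one, Nat.add_comm]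

theorem OpenMask.mem_candidates {n : ℕ} (h : OpenMask n) : n ∈ candidates 16 := by
  have := h.mod_mem_candidates le_rfl
  rwa [Nat.mod_eq_of_lt h.1] at this

instance (n : ℕ) : Decidable (Saturated n) :=
  inferInstanceAs (Decidable (∀ t < 16, _ ∨ _))

/-- The nonempty saturated open masks. -/
def saturatedMasks : List ℕ :=
  -- Openness is tested again because `candidates` checks only preceding types, whereas type 2 has
  -- the later type 3 near it.
  (candidates 16).filter fun n => n ≠ 0 ∧ OpenMask n ∧ Saturated n

theorem mem_saturatedMasks {n : ℕ} :
    n ∈ saturatedMasks ↔ n ≠ 0 ∧ OpenMask n ∧ Saturated n := by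
  rw [saturatedMasks, List.mem_filter, decide_eq_true_eq]
  exact ⟨fun h => h.2, fun h => ⟨h.2.1.mem_candidates, h⟩⟩

theorem length_saturatedMasks : saturatedMasks.length = 496 := by
  decide +kernel

theorem localOrderings_eq : {P : KF → KF → Prop | IsLocalOrdering.{u} P} =
    ordering '' (saturatedMasks.toFinset : Set ℕ) := by
  ext P
  rw [Set.mem_ofPred_eq, isLocalOrdering_iff]
  constructor
  · rintro ⟨n, hn, hn0, rfl⟩
    obtain ⟨m, hm, hle, h⟩ := exists_saturated hn
    -- The bound `n ≤ m` keeps the saturated mask nonzero.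
    exact ⟨m, by simpa using mem_saturatedMasks.2 ⟨by omega, hm⟩, h⟩
  · rintro ⟨n, hn, rfl⟩
    obtain ⟨hn0, hn, -⟩ := mem_saturatedMasks.1 (by simpa using hn)
    exact ⟨n, hn, hn0, rfl⟩

end GaidaEremenko

theorem mainTheorem7 :
    Set.ncard {P : GaidaEremenko.KF → GaidaEremenko.KF → Prop |
      GaidaEremenko.IsLocalOrdering.{u} P} = 496 := by
  rw [GaidaEremenko.localOrderings_eq, Set.InjOn.ncard_image, Set.ncard_coe_finset,
    GaidaEremenko.saturatedMasks, List.toFinset_card_of_nodup ((GaidaEremenko.nodup_candidates 16).filter _)]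
  · exact GaidaEremenko.length_saturatedMasks
  · intro m hm n hn h
    exact GaidaEremenko.eq_of_ordering_eq
      (GaidaEremenko.mem_saturatedMasks.1 (by simpa using hm)).2
      (GaidaEremenko.mem_saturatedMasks.1 (by simpa using hn)).2 h
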